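/- A p-algebra is a bounded distributive lattice with a unary operation $*$ such that $x\wedge y=0$ iff $x\le y^*$. For $m\ge 0$ let $\bar{\mathbf B}_m$ be the p-algebra obtained from the Boolean algebra with $m$ atoms by adding a new top element, and let $\mathsf{Pa}_m=\mathbf{HSP}(\bar{\mathbf B}_m)$ be the variety it generates. For a p-algebra $\mathbf A$ let $\mathbf Q(\mathbf A)$ be the smallest quasivariety of p-algebras containing $\mathbf A$. For a finite poset $P$ let $\varepsilon(P)$ be the p-algebra of upsets of $P$ ordered by inclusion, where $U^*$ is the largest upset disjoint from $U$; for $x\in P$ let $M(x)$ be the set of maximal elements of $P$ above $x$; and let $P^\sharp=\{M(x):x\in P\}$, ordered by reverse inclusion ($A\le B$ iff $B\subseteq A$). **Lemma 2.4.** Let $m\ge 1$ and let $P$ be a finite poset. If $\mathsf{Pa}_m\subsetneq\mathbf Q(\varepsilon(P))$, then $$\mathsf{Pa}_m\subsetneq\mathbf Q(\varepsilon(P^\sharp))\subseteq\mathbf Q(\varepsilon(P)).$$ In particular, if $\mathbf Q(\varepsilon(P))$ is a cover of $\mathsf{Pa}_m$ in the lattice of quasivarieties of p-algebras (that is, $\mathsf{Pa}_m\subsetneq\mathbf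 Q(\varepsilon(P))$ and no quasivariety lies strictly between them), then $\mathbf Q(\varepsilon(P))=\mathbf Q(\varepsilon(P^\sharp))$. -/

import Mathlib

universe u v

/-- A p-algebra: a bounded distributive lattice with a pseudocomplementation `ᶜ`
(written `*` in the literature). -/
class PAlgebra (α : Type u) extends DistribLattice α, BoundedOrder α, Compl α where
  inf_eq_bot_iff_le_compl : ∀ x y : α, x ⊓ y = ⊥ ↔ x ≤ yᶜ

/-- Homomorphisms of p-algebras. -/
structure PAlgHom (α : Type u) (β : Type v) [PAlgebra α] [PAlgebra β]
    extends BoundedLatticeHom α β where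
  map_compl' : ∀ a : α, toFun aᶜ = (toFun a)ᶜ

/-- A bundled p-algebra. -/
structure PAlg where
  carrier : Type u
  [str : PAlgebra carrier]

namespace PAlg

instance : CoeSort PAlg.{u} (Type u) := ⟨PAlg.carrier⟩

instance (A : PAlg.{u}) : PAlgebra A := A.str

/-! ### Products, and the class operators H, S, P (all closed under isomorphism) -/

instance piPAlgebra {I : Type v} (A : I → Type u) [∀ i, PAlgebra (A i)] :
    PAlgebra (∀ i, A i) where
  toDistribLattice := inferInstance
  toBoundedOrder := inferInstance
  toCompl := ⟨fun f i => (f i)ᶜ⟩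
  inf_eq_bot_iff_le_compl f g := by
    simp only [funext_iff, Pi.le_def]
    exact forall_congr' fun i => PAlgebra.inf_eq_bot_iff_le_compl (f i) (g i)

/-- Homomorphic images of members of `K`. -/
def opH (K : Set PAlg.{u}) : Set PAlg.{u} :=
  {B | ∃ A ∈ K, ∃ f : PAlgHom A B, Function.Surjective f.toFun}

/-- Algebras isomorphic to subalgebras of members of `K`. -/
def opS (K : Set PAlg.{u}) : Set PAlg.{u} :=
  {B | ∃ A ∈ K, ∃ f : PAlgHom B A, Function.Injective f.toFun}

/-- Algebras isomorphic to direct products of (possibly empty) families of members of `K`. -/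
def opP (K : Set PAlg.{u}) : Set PAlg.{u} :=
  {B | ∃ (I : Type u) (A : I → PAlg.{u}), (∀ i, A i ∈ K) ∧
    ∃ f : PAlgHom B (∀ i, A i), Function.Bijective f.toFun}

/-! ### Quasi-identities and quasivarieties -/

/-- Terms in the language of p-algebras. -/
inductive PTerm : Type
  | var : ℕ → PTerm
  | bot : PTerm
  | top : PTerm
  | inf : PTerm → PTerm → PTerm
  | sup : PTerm → PTerm → PTerm
  | compl : PTerm → PTerm

/-- The value of a term under an assignment of the variables. -/
def PTerm.eval {α : Type u} [PAlgebra α] (v : ℕ → α) : PTerm → α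
  | .var n => v n
  | .bot => ⊥
  | .top => ⊤
  | .inf s t => s.eval v ⊓ t.eval v
  | .sup s t => s.eval v ⊔ t.eval v
  | .compl t => (t.eval v)ᶜ

/-- A quasi-identity `s₁ ≈ t₁ ∧ ⋯ ∧ sₙ ≈ tₙ → s ≈ t` (with `n = 0` allowed). -/
structure QuasiIdentity where
  premises : List (PTerm × PTerm)
  lhs : PTerm
  rhs : PTerm

/-- `A` satisfies the quasi-identity `q`. -/
def Satisfies (A : PAlg.{u}) (q : QuasiIdentity) : Prop :=
  ∀ v : ℕ → A, (∀ e ∈ q.premises, e.1.eval v = e.2.eval v) → q.lhs.eval v = q.rhs.eval v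

/-- A quasivariety of p-algebras: the class of all models of a set of quasi-identities. -/
def IsQuasivariety (K : Set PAlg.{u}) : Prop :=
  ∃ E : Set QuasiIdentity, K = {A | ∀ q ∈ E, A.Satisfies q}

/-- `Q A`: the smallest quasivariety containing `A`. -/
def Q (A : PAlg.{u}) : Set PAlg.{u} :=
  ⋂₀ {K | IsQuasivariety K ∧ A ∈ K}

/-- For quasivarieties `K` and `L`: `L` covers `K` in the lattice of quasivarieties
of p-algebras. -/
def IsCover (K L : Set PAlg.{u}) : Prop :=
  K ⊂ L ∧ ∀ N : Set PAlg.{u}, IsQuasivariety N → ¬ (K ⊂ N ∧ N ⊂ L)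

/-! ### The algebras generating the varieties `Pa m` -/

/-- The Boolean algebra with `k` atoms together with a new top element. -/
def BBar (k : ℕ) : Type u := WithTop (Set (ULift.{u} (Fin k)))

namespace BBar

instance (k : ℕ) : DistribLattice (BBar.{u} k) :=
  inferInstanceAs (DistribLattice (WithTop (Set (ULift.{u} (Fin k)))))

instance (k : ℕ) : BoundedOrder (BBar.{u} k) :=
  inferInstanceAs (BoundedOrder (WithTop (Set (ULift.{u} (Fin k)))))

open Classical in
/-- The pseudocomplement: the new top goes to `⊥`, the element `⊥` to the new top, and any other
element to its Boolean complement. -/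
noncomputable def star {k : ℕ} : WithTop (Set (ULift.{u} (Fin k))) →
    WithTop (Set (ULift.{u} (Fin k)))
  | none => ⊥
  | some s => if s = ∅ then ⊤ else ((sᶜ : Set (ULift.{u} (Fin k))) : WithTop _)

theorem inf_eq_bot_iff {k : ℕ} (x y : WithTop (Set (ULift.{u} (Fin k)))) :
    x ⊓ y = ⊥ ↔ x ≤ star y := by
  induction y using WithTop.recTopCoe with
  | top =>
    change x ⊓ ⊤ = ⊥ ↔ x ≤ ⊥
    simp
  | coe t =>
    change x ⊓ (t : WithTop _) = ⊥ ↔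
      x ≤ if t = ∅ then ⊤ else ((tᶜ : Set (ULift.{u} (Fin k))) : WithTop _)
    by_cases ht : t = ∅
    · subst ht
      have h : ((∅ : Set (ULift.{u} (Fin k))) : WithTop (Set (ULift.{u} (Fin k)))) = ⊥ := rfl
      simp [h]
    · rw [if_neg ht]
      induction x using WithTop.recTopCoe with
      | top =>
        have h : (t : WithTop (Set (ULift.{u} (Fin k)))) ≠ ⊥ :=
          fun h => ht (WithTop.coe_injective h)
        simp [h]
      | coe s =>
        rw [← WithTop.coe_inf, ← WithTop.coe_bot, WithTop.coe_inj, WithTop.coe_le_coe,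
          ← disjoint_iff, Set.subset_compl_iff_disjoint_right]

noncomputable instance (k : ℕ) : PAlgebra (BBar.{u} k) where
  toCompl := ⟨star⟩
  inf_eq_bot_iff_le_compl := inf_eq_bot_iff

end BBar

/-- The variety `Pa m = HSP(BBar m)`. -/
def Pa (m : ℕ) : Set PAlg.{u} := opH (opS (opP {PAlg.mk (BBar.{u} m)}))

/-! ### The dual algebra of a poset, and the reduction of a poset -/

/-- Upsets of a poset, ordered by inclusion. -/
def Upset (P : Type u) [PartialOrder P] : Type u := {U : Set P // IsUpperSet U}

namespace Upset

variable {P : Type u} [PartialOrder P]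

instance : DistribLattice (Upset P) where
  le U V := U.1 ⊆ V.1
  le_refl _ := subset_rfl
  le_trans _ _ _ := Set.Subset.trans
  le_antisymm _ _ h h2 := Subtype.ext (Set.Subset.antisymm h h2)
  sup U V := ⟨U.1 ∪ V.1, U.2.union V.2⟩
  inf U V := ⟨U.1 ∩ V.1, U.2.inter V.2⟩
  le_sup_left _ _ := Set.subset_union_left
  le_sup_right _ _ := Set.subset_union_right
  sup_le _ _ _ := Set.union_subset
  inf_le_left _ _ := Set.inter_subset_left
  inf_le_right _ _ := Set.inter_subset_right
  le_inf _ _ _ := Set.subset_inter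
  le_sup_inf U V W := (Set.union_inter_distrib_left U.1 V.1 W.1).ge

instance : BoundedOrder (Upset P) where
  top := ⟨Set.univ, isUpperSet_univ⟩
  le_top _ := Set.subset_univ _
  bot := ⟨∅, isUpperSet_empty⟩
  bot_le _ := Set.empty_subset _

/-- The pseudocomplement of `U` is the largest upset disjoint from `U`. -/
instance : PAlgebra (Upset P) where
  toCompl := ⟨fun U => ⟨{x | ∀ y, x ≤ y → y ∉ U.1}, fun _ _ hxy hx z hz => hx z (hxy.trans hz)⟩⟩
  inf_eq_bot_iff_le_compl U V := by
    constructor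
    · intro h x hx y hxy hy
      have hmem : y ∈ (U ⊓ V).1 := ⟨U.2 hxy hx, hy⟩
      rw [h] at hmem
      exact hmem
    · intro h
      refine Subtype.ext (Set.eq_empty_iff_forall_notMem.mpr ?_)
      rintro x ⟨hxU, hxV⟩
      exact h hxU x le_rfl hxV

end Upset

/-- The dual p-algebra `ε(P)` of a poset `P`: the algebra of its upsets. -/
def dualAlg (P : Type u) [PartialOrder P] : PAlg.{u} := PAlg.mk (Upset P)

/-- `maxAbove x` is the set `M(x)` of maximal elements above `x`. -/
def maxAbove {P : Type u} [PartialOrder P] (x : P) : Set P := {y | x ≤ y ∧ IsMax y}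

/-- The reduction `P♯ = {M(x) : x ∈ P}` of a poset. -/
def Sharp (P : Type u) [PartialOrder P] : Type u := {A : Set P // ∃ x : P, A = maxAbove x}

/-- The reduction is ordered by reverse inclusion. -/
instance (P : Type u) [PartialOrder P] : PartialOrder (Sharp P) where
  le A B := B.1 ⊆ A.1
  le_refl _ := subset_rfl
  le_trans _ _ _ h h2 := Set.Subset.trans h2 h
  le_antisymm _ _ h h2 := Subtype.ext (Set.Subset.antisymm h2 h)

end PAlg

/-! For `1 ≤ m`, membership in `Pa m` amounts to one quasi-identity, `DisjointComplSup m`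
(`mem_Pa_iff`). It holds in `BBar m` and survives H, S and P; conversely it allows at most `m`
maximal filters above a prime filter, so homomorphisms into `BBar m` separate points. Hence `Q A ⊆
Pa m` once `A` satisfies it, and `Pa m ⊆ Q A` once `BBar m ∈ Q A`.

The map `x ↦ M(x)` embeds `ε(P♯)` into `ε(P)`, which gives the inclusion of quasivarieties. The
image contains every pseudocomplement, since whether `x ∈ Uᶜ` depends only on `M(x)`. As
`DisjointComplSup` involves its elements only up to double pseudocomplement, its failure in `ε(P)`
passes to `ε(P♯)` (`disjointComplSup_of_sharp`), so `Q(ε(P♯)) ⊄ Pa m`.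

It remains to put `BBar m` in `Q(ε(P♯))`. For `2 ≤ m` it is generated by pseudocomplements, so each
homomorphism into `ε(P)` lifts to `ε(P♯)` (`BBar_mem_Q_sharp`). For `m = 1` a dense element other
than `⊤` in `ε(P♯)` gives the three-element chain. -/

namespace PAlgebra

/-! ### Arithmetic of pseudocomplements -/

variable {α : Type u} [PAlgebra α]

theorem le_compl_iff {x y : α} : x ≤ yᶜ ↔ x ⊓ y = ⊥ :=
  (inf_eq_bot_iff_le_compl x y).symm

theorem inf_compl_eq_bot (x : α) : x ⊓ xᶜ = ⊥ := by
  rw [inf_comm]; exact le_compl_iff.1 le_rfl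

theorem compl_inf_eq_bot (x : α) : xᶜ ⊓ x = ⊥ := le_compl_iff.1 le_rfl

theorem le_compl_compl (x : α) : x ≤ xᶜᶜ := le_compl_iff.2 (inf_compl_eq_bot x)

theorem compl_anti {x y : α} (h : x ≤ y) : yᶜ ≤ xᶜ :=
  le_compl_iff.2 (le_bot_iff.1 ((inf_le_inf_left _ h).trans (compl_inf_eq_bot y).le))

theorem compl_compl_compl_eq (x : α) : xᶜᶜᶜ = xᶜ :=
  le_antisymm (compl_anti (le_compl_compl x)) (le_compl_compl _)

theorem compl_bot_eq : (⊥ : α)ᶜ = ⊤ := top_le_iff.1 (le_compl_iff.2 (inf_bot_eq _))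

theorem compl_top_eq : (⊤ : α)ᶜ = ⊥ := by
  simpa using inf_compl_eq_bot (⊤ : α)

/-- Among any `m + 1` pairwise disjoint elements the pseudocomplements join to `⊤`. This
property characterizes the members of `Pa m` for `m ≥ 1`. -/
def DisjointComplSup (m : ℕ) (α : Type u) [PAlgebra α] : Prop :=
  ∀ x : Fin (m + 1) → α, (∀ i j, i ≠ j → x i ⊓ x j = ⊥) →
    Finset.univ.sup (fun i => (x i)ᶜ) = ⊤

/-! ### Prime filters -/

/-- Proper filters, as sets. -/
structure IsProperFilter (F : Set α) : Prop where
  top_mem : ⊤ ∈ F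
  bot_notMem : ⊥ ∉ F
  inf_mem : ∀ {a b}, a ∈ F → b ∈ F → a ⊓ b ∈ F
  mem_of_le : ∀ {a b}, a ≤ b → a ∈ F → b ∈ F

/-- Prime filters, as sets. -/
structure IsPrimeFilter (F : Set α) : Prop extends IsProperFilter F where
  mem_or_mem : ∀ {a b}, a ⊔ b ∈ F → a ∈ F ∨ b ∈ F

/-- Maximal filters, described by the fact that they decide every element. -/
structure IsMaxFilter (F : Set α) : Prop extends IsProperFilter F where
  compl_mem : ∀ {a}, a ∉ F → aᶜ ∈ F

theorem IsProperFilter.compl_notMem {F : Set α} (hF : IsProperFilter F) {a : α} (ha : a ∈ F) :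
    aᶜ ∉ F := fun h => hF.bot_notMem (inf_compl_eq_bot a ▸ hF.inf_mem ha h)

theorem IsProperFilter.inf_mem_iff {F : Set α} (hF : IsProperFilter F) {a b : α} :
    a ⊓ b ∈ F ↔ a ∈ F ∧ b ∈ F :=
  ⟨fun h => ⟨hF.mem_of_le inf_le_left h, hF.mem_of_le inf_le_right h⟩, fun h => hF.inf_mem h.1 h.2⟩

theorem IsProperFilter.finset_inf_mem {F : Set α} (hF : IsProperFilter F) {ι : Type*}
    (s : Finset ι) (f : ι → α) (h : ∀ i ∈ s, f i ∈ F) : s.inf f ∈ F :=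
  Finset.inf_induction hF.top_mem (fun _ ha _ hb => hF.inf_mem ha hb) h

theorem IsPrimeFilter.sup_mem_iff {F : Set α} (hF : IsPrimeFilter F) {a b : α} :
    a ⊔ b ∈ F ↔ a ∈ F ∨ b ∈ F :=
  ⟨hF.mem_or_mem, fun h => h.elim (hF.mem_of_le le_sup_left) (hF.mem_of_le le_sup_right)⟩

theorem IsPrimeFilter.exists_mem_of_sup_mem {F : Set α} (hF : IsPrimeFilter F) {ι : Type*}
    (s : Finset ι) (f : ι → α) (h : s.sup f ∈ F) : ∃ i ∈ s, f i ∈ F := by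
  classical
  induction s using Finset.induction_on with
  | empty => exact (hF.bot_notMem (by simpa using h)).elim
  | insert i s _ ih =>
    rw [Finset.sup_insert] at h
    rcases hF.mem_or_mem h with h | h
    · exact ⟨i, by simp, h⟩
    · obtain ⟨j, hj, hj'⟩ := ih h
      exact ⟨j, by simp [hj], hj'⟩

theorem IsMaxFilter.isPrimeFilter {F : Set α} (hF : IsMaxFilter F) : IsPrimeFilter F where
  toIsProperFilter := hF.toIsProperFilter
  mem_or_mem {a b} h := by
    by_contra! hab
    have := hF.inf_mem h (hF.inf_mem (hF.compl_mem hab.1) (hF.compl_mem hab.2))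
    refine hF.bot_notMem (hF.mem_of_le ?_ this)
    rw [inf_sup_right]
    refine sup_le ?_ ?_
    · exact (inf_le_inf_left _ inf_le_left).trans (inf_compl_eq_bot a).le
    · exact (inf_le_inf_left _ inf_le_right).trans (inf_compl_eq_bot b).le

theorem IsMaxFilter.eq_of_subset {F G : Set α} (hF : IsMaxFilter F) (hG : IsMaxFilter G)
    (h : F ⊆ G) : F = G :=
  h.antisymm fun x hx => by
    by_contra hx'
    exact hG.compl_notMem hx (h (hF.compl_mem hx'))

/-- The complement of a prime ideal that contains `b` and misses the principal filter of `a`. -/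
theorem exists_isPrimeFilter {a b : α} (h : ¬ a ≤ b) :
    ∃ F : Set α, IsPrimeFilter F ∧ a ∈ F ∧ b ∉ F := by
  obtain ⟨J, hJ, hbJ, hdis⟩ := DistribLattice.prime_ideal_of_disjoint_filter_ideal
    (F := Order.PFilter.principal a) (I := Order.Ideal.principal b) (by
      rw [Set.disjoint_left]
      intro x hx hx'
      exact h (le_trans (Order.PFilter.mem_principal.1 hx) (Order.Ideal.mem_principal.1 hx')))
  have hle : ∀ {x y : α}, x ≤ y → y ∈ J → x ∈ J := fun hxy hy => J.lower hxy hy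
  have ha : a ∉ J := fun ha => Set.disjoint_left.1 hdis (Order.PFilter.mem_principal.2 le_rfl) ha
  refine ⟨{x | x ∉ J}, ⟨⟨?_, ?_, ?_, ?_⟩, ?_⟩, ha, ?_⟩
  · exact fun h => ha (hle le_top h)
  · exact fun h => h J.bot_mem
  · intro x y hx hy hxy
    exact (hJ.mem_or_mem hxy).elim hx hy
  · exact fun hxy hx hy => hx (hle hxy hy)
  · intro x y hxy
    by_contra! hcon
    simp only [Set.mem_ofPred_eq, not_not] at hcon hxy
    exact hxy (Order.Ideal.sup_mem hcon.1 hcon.2)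
  · exact fun hb => hb (hbJ (Order.Ideal.mem_principal.2 le_rfl))

/-- The filter generated by a filter and an element. -/
def adjoin (F : Set α) (a : α) : Set α := {y | ∃ g ∈ F, g ⊓ a ≤ y}

theorem isProperFilter_adjoin {F : Set α} (hF : IsProperFilter F) {a : α} (ha : aᶜ ∉ F) :
    IsProperFilter (adjoin F a) where
  top_mem := ⟨⊤, hF.top_mem, le_top⟩
  bot_notMem := fun ⟨_, hg, h⟩ => ha (hF.mem_of_le (le_compl_iff.2 (le_bot_iff.1 h)) hg)
  inf_mem := by
    rintro x y ⟨g, hg, hx⟩ ⟨k, hk, hy⟩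
    exact ⟨g ⊓ k, hF.inf_mem hg hk, le_inf ((inf_le_inf_right _ inf_le_left).trans hx)
      ((inf_le_inf_right _ inf_le_right).trans hy)⟩
  mem_of_le := fun hxy ⟨g, hg, h⟩ => ⟨g, hg, h.trans hxy⟩

theorem subset_adjoin (F : Set α) (a : α) : F ⊆ adjoin F a :=
  fun x hx => ⟨x, hx, inf_le_left⟩

theorem mem_adjoin {F : Set α} (hF : IsProperFilter F) (a : α) : a ∈ adjoin F a :=
  ⟨⊤, hF.top_mem, inf_le_right⟩

/-- Zorn's lemma applied above `adjoin F a`. The result decides every `x`: if `xᶜ ∉ G`, adjoining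
`x` keeps `G` proper, so `x ∈ G` by maximality. -/
theorem exists_isMaxFilter {F : Set α} (hF : IsProperFilter F) {a : α} (ha : aᶜ ∉ F) :
    ∃ G, IsMaxFilter G ∧ F ⊆ G ∧ a ∈ G := by
  obtain ⟨G, hFG, hG⟩ := zorn_subset_nonempty {G : Set α | IsProperFilter G} (by
    intro c hc hchain hne
    refine ⟨⋃₀ c, ?_, fun s hs => Set.subset_sUnion_of_mem hs⟩
    obtain ⟨s₀, hs₀⟩ := hne
    refine ⟨⟨s₀, hs₀, (hc hs₀).top_mem⟩, ?_, ?_, ?_⟩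
    · rintro ⟨s, hs, h⟩
      exact (hc hs).bot_notMem h
    · rintro x y ⟨s, hs, hx⟩ ⟨t, ht, hy⟩
      rcases hchain.total hs ht with h | h
      · exact ⟨t, ht, (hc ht).inf_mem (h hx) hy⟩
      · exact ⟨s, hs, (hc hs).inf_mem hx (h hy)⟩
    · rintro x y hxy ⟨s, hs, hx⟩
      exact ⟨s, hs, (hc hs).mem_of_le hxy hx⟩) _ (isProperFilter_adjoin hF ha)
  have hGp : IsProperFilter G := hG.1
  refine ⟨G, ⟨hGp, ?_⟩, (subset_adjoin F a).trans hFG, hFG (mem_adjoin hF a)⟩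
  intro x hx
  by_contra hx'
  exact hx (hG.2 (isProperFilter_adjoin hGp hx') (subset_adjoin G x) (mem_adjoin hGp x))

/-- In an algebra with `DisjointComplSup m` at most `m` maximal filters lie above a prime one. -/
theorem DisjointComplSup.not_injective {m : ℕ} (hα : DisjointComplSup m α) {F : Set α}
    (hF : IsPrimeFilter F) (G : Fin (m + 1) → Set α) (hG : ∀ i, IsMaxFilter (G i))
    (hFG : ∀ i, F ⊆ G i) : ¬ Function.Injective G := by
  intro hinj
  have hex : ∀ i j, ∃ a, i ≠ j → a ∈ G i ∧ a ∉ G j := by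
    intro i j
    by_cases hij : i = j
    · exact ⟨⊤, fun h => (h hij).elim⟩
    · have : ¬ G i ⊆ G j := fun h => hij (hinj ((hG i).eq_of_subset (hG j) h))
      obtain ⟨a, ha⟩ := Set.not_subset.1 this
      exact ⟨a, fun _ => ha⟩
  choose a ha using hex
  -- The meet `b i` stays in `G i`, and `b i ≤ a i j`, `b j ≤ (a i j)ᶜ` make the `b i` pairwise
  -- disjoint. Some `(b i)ᶜ` then lies in `F ⊆ G i`, next to `b i`. The diagonal value `⊤` is
  -- neutral.
  let t : Fin (m + 1) → Fin (m + 1) → α := fun i j => if i = j then ⊤ else a i j ⊓ (a j i)ᶜ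
  let b : Fin (m + 1) → α := fun i => Finset.univ.inf (t i)
  have hb : ∀ i, b i ∈ G i := by
    intro i
    refine (hG i).finset_inf_mem _ _ fun j _ => ?_
    by_cases hij : i = j
    · simpa [t, hij] using (hG j).top_mem
    · simp only [t, if_neg hij]
      exact (hG i).inf_mem (ha i j hij).1 ((hG i).compl_mem (ha j i (Ne.symm hij)).2)
  have hdis : ∀ i j, i ≠ j → b i ⊓ b j = ⊥ := by
    intro i j hij
    have hi : b i ≤ a i j := by
      have : b i ≤ t i j := Finset.inf_le (Finset.mem_univ j)
      simp only [t, if_neg hij] at this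
      exact this.trans inf_le_left
    have hj : b j ≤ (a i j)ᶜ := by
      have : b j ≤ t j i := Finset.inf_le (Finset.mem_univ i)
      simp only [t, if_neg (Ne.symm hij)] at this
      exact this.trans inf_le_right
    exact le_bot_iff.1 ((inf_le_inf hi hj).trans (inf_compl_eq_bot _).le)
  obtain ⟨i, -, hi⟩ := hF.exists_mem_of_sup_mem _ _ (hα b hdis ▸ hF.top_mem)
  exact (hG i).compl_notMem (hb i) (hFG i hi)

/-- Repetitions are allowed, so that the target below is always `BBar m`, even when fewer than `m`
maximal filters lie above `F`. -/
theorem DisjointComplSup.exists_maxFilters {m : ℕ} (hα : DisjointComplSup m α)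
    {F : Set α} (hF : IsPrimeFilter F) :
    ∃ G : Fin m → Set α, Set.range G = {G | IsMaxFilter G ∧ F ⊆ G} := by
  set S : Set (Set α) := {G | IsMaxFilter G ∧ F ⊆ G} with hS
  have hno : ¬ ∃ G : Fin (m + 1) → S, Function.Injective G := by
    rintro ⟨G, hG⟩
    exact hα.not_injective hF (fun i => (G i : Set α)) (fun i => (G i).2.1) (fun i => (G i).2.2)
      (Subtype.val_injective.comp hG)
  have hfin : Finite S := by
    by_contra h
    have : Infinite S := not_finite_iff_infinite.1 h
    exact hno ⟨fun i => Infinite.natEmbedding S i,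
      (Infinite.natEmbedding S).injective.comp Fin.val_injective⟩
  have hcard : Nat.card S ≤ m := by
    by_contra! h
    exact hno ⟨fun i => (Finite.equivFin S).symm (Fin.castLE h i),
      (Equiv.injective _).comp (Fin.castLE_injective h)⟩
  have hne : Nonempty S := by
    obtain ⟨G, hG, hFG, -⟩ := exists_isMaxFilter hF.toIsProperFilter (a := ⊤)
      (by rw [compl_top_eq]; exact hF.bot_notMem)
    exact ⟨⟨G, hG, hFG⟩⟩
  let f : S → Fin m := fun s => Fin.castLE hcard (Finite.equivFin S s)
  have hf : Function.Injective f := (Fin.castLE_injective hcard).comp (Equiv.injective _)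
  refine ⟨fun i => (Function.invFun f i).1, Set.ext fun G => ⟨?_, fun hG => ?_⟩⟩
  · rintro ⟨i, rfl⟩
    exact (Function.invFun f i).2
  · exact ⟨f ⟨G, hG⟩, by simp [Function.leftInverse_invFun hf ⟨G, hG⟩]⟩

end PAlgebra

namespace PAlg

open PAlgebra

/-! ### Membership in `Pa m` -/

namespace BBar

/-- A subset of the atoms as an element of `BBar k`. -/
def ofSet {k : ℕ} (s : Set (ULift.{u} (Fin k))) : BBar.{u} k :=
  ((s : Set (ULift.{u} (Fin k))) : WithTop (Set (ULift.{u} (Fin k))))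

theorem ofSet_empty {k : ℕ} : ofSet (∅ : Set (ULift.{u} (Fin k))) = ⊥ := rfl

theorem ofSet_injective {k : ℕ} : Function.Injective (ofSet : _ → BBar.{u} k) :=
  WithTop.coe_injective

theorem ofSet_ne_top {k : ℕ} (s : Set (ULift.{u} (Fin k))) : ofSet s ≠ ⊤ := WithTop.coe_ne_top

theorem ofSet_inf {k : ℕ} (s t : Set (ULift.{u} (Fin k))) :
    ofSet s ⊓ ofSet t = ofSet (s ∩ t) := rfl

theorem ofSet_sup {k : ℕ} (s t : Set (ULift.{u} (Fin k))) :
    ofSet s ⊔ ofSet t = ofSet (s ∪ t) := rfl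

theorem compl_ofSet {k : ℕ} {s : Set (ULift.{u} (Fin k))} (hs : s ≠ ∅) :
    (ofSet s)ᶜ = ofSet sᶜ := if_neg hs

theorem eq_top_or_eq_ofSet {k : ℕ} (x : BBar.{u} k) : x = ⊤ ∨ ∃ s, x = ofSet s := by
  cases x using WithTop.recTopCoe with
  | top => exact Or.inl rfl
  | coe s => exact Or.inr ⟨s, rfl⟩

/-- If the join is not `⊤`, no `x i` is `⊥`; none is `⊤` either, because `1 ≤ m` provides a second
element disjoint from it. What remains is `m + 1` disjoint nonempty sets of `m` atoms. -/
theorem disjointComplSup {m : ℕ} (hm : 1 ≤ m) : DisjointComplSup m (BBar.{u} m) := by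
  intro x hx
  by_contra hne
  have hbot : ∀ i, x i ≠ ⊥ := by
    intro i hi
    refine hne (top_le_iff.1 ?_)
    have := Finset.le_sup (f := fun i => (x i)ᶜ) (Finset.mem_univ i)
    simpa [hi, compl_bot_eq] using this
  have hs : ∀ i, ∃ s, x i = ofSet s := by
    intro i
    refine (eq_top_or_eq_ofSet (x i)).resolve_left fun hi => ?_
    have : Nontrivial (Fin (m + 1)) := Fin.nontrivial_iff_two_le.2 (by omega)
    obtain ⟨j, hj⟩ := exists_ne i
    exact hbot j (by simpa [hi] using hx i j hj.symm)
  choose s hs using hs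
  have hne : ∀ i, (s i).Nonempty := by
    intro i
    rw [Set.nonempty_iff_ne_empty]
    intro h
    exact hbot i (by rw [hs, h, ofSet_empty])
  choose t ht using hne
  have hinj : Function.Injective t := by
    intro i j hij
    by_contra hne
    have h := hx i j hne
    rw [hs, hs, ofSet_inf, ← ofSet_empty] at h
    have h' := ofSet_injective h
    have : t i ∈ s i ∩ s j := ⟨ht i, hij ▸ ht j⟩
    rw [h'] at this
    exact this
  have := Fintype.card_le_of_injective t hinj
  simp at this

end BBar

theorem _root_.PAlgebra.DisjointComplSup.of_injective {m : ℕ} {α : Type u} {β : Type v} [PAlgebra α] [PAlgebra β]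
    (hβ : DisjointComplSup m β) (f : PAlgHom α β) (hf : Function.Injective f.toFun) :
    DisjointComplSup m α := by
  intro x hx
  apply hf
  have h := hβ (fun i => f.toFun (x i)) fun i j hij => by
    rw [← f.map_bot', ← hx i j hij]
    exact (f.map_inf' _ _).symm
  have h2 := map_finset_sup f.toBoundedLatticeHom Finset.univ (fun i => (x i)ᶜ)
  refine Eq.trans h2 (Eq.trans ?_ (h.trans f.map_top'.symm))
  exact Finset.sup_congr rfl fun i _ => f.map_compl' _

theorem _root_.PAlgebra.DisjointComplSup.pi {m : ℕ} {I : Type v} {A : I → Type u} [∀ i, PAlgebra (A i)]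
    (h : ∀ i, DisjointComplSup m (A i)) : DisjointComplSup m (∀ i, A i) := by
  intro x hx
  funext k
  rw [Finset.sup_apply]
  exact h k (fun i => x i k) fun i j hij => congrFun (hx i j hij) k

/-- Preimages `c i` of disjoint elements need not be disjoint. Cutting each down to `c i ⊓ ⋀ (c j)ᶜ`
over `j ≠ i` makes them so without changing the images. -/
theorem _root_.PAlgebra.DisjointComplSup.of_surjective {m : ℕ} {α : Type u} {β : Type v} [PAlgebra α] [PAlgebra β]
    (hα : DisjointComplSup m α) (f : PAlgHom α β) (hf : Function.Surjective f.toFun) :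
    DisjointComplSup m β := by
  intro x hx
  choose c hc using fun i => hf (x i)
  let t : Fin (m + 1) → Fin (m + 1) → α := fun i j => if i = j then ⊤ else (c j)ᶜ
  let b : Fin (m + 1) → α := fun i => c i ⊓ Finset.univ.inf (t i)
  have hb : ∀ i, f.toFun (b i) = x i := by
    intro i
    have h1 : f.toFun (b i) = f.toFun (c i) ⊓ Finset.univ.inf (fun j => f.toFun (t i j)) :=
      (f.map_inf' _ _).trans
        (congrArg _ (map_finset_inf f.toBoundedLatticeHom Finset.univ (t i)))
    rw [h1, hc, inf_eq_left]
    refine Finset.le_inf fun j _ => ?_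
    by_cases hij : i = j
    · simp only [t, if_pos hij]
      exact le_top.trans f.map_top'.ge
    · simp only [t, if_neg hij]
      rw [f.map_compl', hc, le_compl_iff]
      exact hx i j hij
  have hdis : ∀ i j, i ≠ j → b i ⊓ b j = ⊥ := by
    intro i j hij
    have hi : b i ≤ (c j)ᶜ := by
      have : b i ≤ t i j := inf_le_right.trans (Finset.inf_le (Finset.mem_univ j))
      simpa only [t, if_neg hij] using this
    have hj : b j ≤ c j := inf_le_left
    exact le_bot_iff.1 ((inf_le_inf hi hj).trans (compl_inf_eq_bot _).le)
  have h := congrArg f.toFun (hα b hdis)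
  have h2 := map_finset_sup f.toBoundedLatticeHom Finset.univ (fun i => (b i)ᶜ)
  refine Eq.trans ?_ (h2.symm.trans (h.trans f.map_top'))
  refine Finset.sup_congr rfl fun i _ => ?_
  exact (congrArg _ (hb i).symm).trans (f.map_compl' _).symm

theorem disjointComplSup_of_mem_Pa {m : ℕ} (hm : 1 ≤ m) {A : PAlg.{u}} (hA : A ∈ Pa.{u} m) :
    DisjointComplSup m A := by
  obtain ⟨B, ⟨C, ⟨I, D, hD, f, hf⟩, g, hg⟩, h, hh⟩ := hA
  have hD' : ∀ i, DisjointComplSup m (D i) := by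
    intro i
    rw [Set.mem_singleton_iff.1 (hD i)]
    exact BBar.disjointComplSup hm
  have hC : DisjointComplSup m C := (DisjointComplSup.pi hD').of_injective f hf.1
  exact (hC.of_injective g hg).of_surjective h hh

open Classical in
/-- The homomorphism into `BBar m` given by a prime filter and the maximal filters above it. -/
noncomputable def homOfFilters {α : Type u} [PAlgebra α] {m : ℕ} {F : Set α}
    (hF : IsPrimeFilter F) (G : Fin m → Set α)
    (hG : Set.range G = {G | IsMaxFilter G ∧ F ⊆ G}) : PAlgHom α (BBar.{u} m) :=
  have hmax : ∀ i, IsMaxFilter (G i) := fun i => (hG.le ⟨i, rfl⟩).1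
  have hsub : ∀ i, F ⊆ G i := fun i => (hG.le ⟨i, rfl⟩).2
  { toFun := fun x => if x ∈ F then ⊤ else BBar.ofSet {i | x ∈ G i.down}
    map_sup' := fun x y => by
      by_cases hx : x ∈ F
      · simp [hx, hF.sup_mem_iff]
      by_cases hy : y ∈ F
      · simp [hy, hF.sup_mem_iff]
      simp only [hx, hy, hF.sup_mem_iff, or_self, if_false, BBar.ofSet_sup]
      congr 1
      ext i
      exact (hmax _).isPrimeFilter.sup_mem_iff
    map_inf' := fun x y => by
      by_cases hx : x ∈ F
      · by_cases hy : y ∈ F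
        · simp [hx, hy, hF.inf_mem_iff]
        · simp [hx, hy, hF.inf_mem_iff, (hmax _).inf_mem_iff, hsub _ hx]
      by_cases hy : y ∈ F
      · simp [hx, hy, hF.inf_mem_iff, (hmax _).inf_mem_iff, hsub _ hy]
      simp only [hx, hy, hF.inf_mem_iff, and_self, if_false, BBar.ofSet_inf]
      congr 1
      ext i
      exact (hmax _).inf_mem_iff
    map_top' := by simp [hF.top_mem]
    map_bot' := by
      simp only [hF.bot_notMem, if_false, (hmax _).bot_notMem]
      rfl
    map_compl' := fun x => by
      by_cases hx : x ∈ F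
      · have h1 : ∀ i, xᶜ ∉ G i := fun i => (hmax i).compl_notMem (hsub i hx)
        simp only [hx, hF.compl_notMem hx, if_false, if_true, h1]
        rfl
      by_cases hx' : xᶜ ∈ F
      · have h1 : ∀ i, x ∉ G i := fun i h => (hmax i).compl_notMem h (hsub i hx')
        simp only [hx, hx', if_false, if_true, h1]
        exact (compl_bot_eq (α := BBar.{u} m)).symm
      -- A maximal filter above `F` contains `x`, so the atom set of `x` is nonempty and its
      -- pseudocomplement is the Boolean one.
      · obtain ⟨H, hH, hFH, hxH⟩ := exists_isMaxFilter hF.toIsProperFilter hx'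
        obtain ⟨i, rfl⟩ := hG.ge ⟨hH, hFH⟩
        have hne : {i : ULift.{u} (Fin m) | x ∈ G i.down} ≠ ∅ :=
          Set.nonempty_iff_ne_empty.1 ⟨⟨i⟩, hxH⟩
        simp only [hx, hx', if_false]
        rw [BBar.compl_ofSet hne]
        congr 1
        ext j
        exact ⟨fun h h' => (hmax _).compl_notMem h' h, fun h => (hmax _).compl_mem h⟩ }

theorem exists_hom_ne {α : Type u} [PAlgebra α] {m : ℕ} (hα : DisjointComplSup m α)
    {a b : α} (hab : a ≠ b) : ∃ f : PAlgHom α (BBar.{u} m), f.toFun a ≠ f.toFun b := by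
  wlog h : ¬ a ≤ b generalizing a b
  · obtain ⟨f, hf⟩ := this hab.symm fun h' => hab (le_antisymm (not_not.1 h) h')
    exact ⟨f, hf.symm⟩
  obtain ⟨F, hF, ha, hb⟩ := exists_isPrimeFilter h
  obtain ⟨G, hG⟩ := hα.exists_maxFilters hF
  refine ⟨homOfFilters hF G hG, ?_⟩
  simp only [homOfFilters, if_pos ha, if_neg hb]
  exact (BBar.ofSet_ne_top _).symm

/-- The identity homomorphism. -/
def idHom (α : Type u) [PAlgebra α] : PAlgHom α α where
  toBoundedLatticeHom := BoundedLatticeHom.id α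
  map_compl' _ := rfl

/-- The homomorphism into a product with given components. -/
def piHom {α : Type u} [PAlgebra α] {I : Type v} {A : I → Type u} [∀ i, PAlgebra (A i)]
    (f : ∀ i, PAlgHom α (A i)) : PAlgHom α (∀ i, A i) where
  toFun a i := (f i).toFun a
  map_sup' _ _ := funext fun i => (f i).map_sup' _ _
  map_inf' _ _ := funext fun i => (f i).map_inf' _ _
  map_top' := funext fun i => (f i).map_top'
  map_bot' := funext fun i => (f i).map_bot'
  map_compl' _ := funext fun i => (f i).map_compl' _

/-- Conversely, `A` embeds in the power of `BBar m` indexed by all homomorphisms into it. -/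
theorem mem_Pa_iff {m : ℕ} (hm : 1 ≤ m) {A : PAlg.{u}} : A ∈ Pa.{u} m ↔ DisjointComplSup m A := by
  refine ⟨disjointComplSup_of_mem_Pa hm, fun hA => ?_⟩
  refine ⟨A, ⟨PAlg.mk (PAlgHom A (BBar.{u} m) → BBar.{u} m), ⟨PAlgHom A (BBar.{u} m),
    fun _ => PAlg.mk (BBar.{u} m), fun _ => rfl, idHom _, Function.bijective_id⟩,
    piHom fun f => f, ?_⟩, idHom A, Function.surjective_id⟩
  intro a b hab
  by_contra hne
  obtain ⟨f, hf⟩ := exists_hom_ne hA hne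
  exact hf (congrFun hab f)

/-! ### Quasivarieties -/

theorem mem_Q_iff {A B : PAlg.{u}} :
    B ∈ Q A ↔ ∀ q : QuasiIdentity, A.Satisfies q → B.Satisfies q := by
  constructor
  · intro h
    exact h _ ⟨⟨{q | A.Satisfies q}, rfl⟩, fun _ hq => hq⟩
  · rintro h K ⟨⟨E, rfl⟩, hA⟩ q hq
    exact h q (hA q hq)

theorem isQuasivariety_Q (A : PAlg.{u}) : IsQuasivariety (Q A) :=
  ⟨{q | A.Satisfies q}, Set.ext fun _ => mem_Q_iff⟩

theorem Q_subset {A B : PAlg.{u}} (h : B ∈ Q A) : Q B ⊆ Q A := fun _ hC =>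
  mem_Q_iff.2 fun q hq => mem_Q_iff.1 hC q (mem_Q_iff.1 h q hq)

theorem self_mem_Q (A : PAlg.{u}) : A ∈ Q A := mem_Q_iff.2 fun _ h => h

theorem map_eval {α : Type u} {β : Type v} [PAlgebra α] [PAlgebra β] (f : PAlgHom α β)
    (v : ℕ → α) (t : PTerm) : f.toFun (t.eval v) = t.eval (fun n => f.toFun (v n)) := by
  induction t with
  | var n => rfl
  | bot => exact f.map_bot'
  | top => exact f.map_top'
  | inf s t hs ht => exact (f.map_inf' _ _).trans (congrArg₂ _ hs ht)
  | sup s t hs ht => exact (f.map_sup' _ _).trans (congrArg₂ _ hs ht)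
  | compl t ht => exact (f.map_compl' _).trans (congrArg _ ht)

/-- A homomorphism separating the two sides carries a failure of a quasi-identity from `B` to `A`.
-/
theorem mem_Q_of_separated {A B : PAlg.{u}}
    (h : ∀ a b : B, a ≠ b → ∃ f : PAlgHom B A, f.toFun a ≠ f.toFun b) : B ∈ Q A := by
  refine mem_Q_iff.2 fun q hq v hv => ?_
  by_contra hne
  obtain ⟨f, hf⟩ := h _ _ hne
  refine hf ?_
  rw [map_eval, map_eval]
  refine hq _ fun e he => ?_
  rw [← map_eval, ← map_eval, hv e he]

theorem mem_Q_of_injective {A B : PAlg.{u}} (f : PAlgHom B A) (hf : Function.Injective f.toFun) :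
    B ∈ Q A :=
  mem_Q_of_separated fun _ _ hab => ⟨f, fun h => hab (hf h)⟩

/-- The join of a list of terms. -/
def joinTerm (l : List PTerm) : PTerm := l.foldr PTerm.sup PTerm.bot

theorem eval_joinTerm_le {α : Type u} [PAlgebra α] (v : ℕ → α) (l : List PTerm) (z : α) :
    (joinTerm l).eval v ≤ z ↔ ∀ t ∈ l, t.eval v ≤ z := by
  induction l with
  | nil => simp [joinTerm, PTerm.eval]
  | cons t l ih =>
    rw [List.forall_mem_cons, ← ih]
    exact sup_le_iff

/-- The quasi-identity expressing `DisjointComplSup m`. -/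
def disjointIdentity (m : ℕ) : QuasiIdentity where
  premises := (((List.finRange (m + 1)).product (List.finRange (m + 1))).filter
    fun p => p.1 ≠ p.2).map fun p => (.inf (.var p.1) (.var p.2), .bot)
  lhs := joinTerm ((List.finRange (m + 1)).map fun i => .compl (.var i))
  rhs := .top

theorem satisfies_disjointIdentity {m : ℕ} {A : PAlg.{u}} :
    A.Satisfies (disjointIdentity m) ↔ DisjointComplSup m A := by
  have key : ∀ v : ℕ → A, (disjointIdentity m).lhs.eval v =
      Finset.univ.sup fun i : Fin (m + 1) => (v i)ᶜ := fun v =>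
    eq_of_forall_ge_iff fun z => by
      simp [disjointIdentity, eval_joinTerm_le, PTerm.eval]
  have key2 : ∀ v : ℕ → A, (∀ e ∈ (disjointIdentity m).premises, e.1.eval v = e.2.eval v) ↔
      ∀ i j : Fin (m + 1), i ≠ j → v i ⊓ v j = ⊥ := by
    intro v
    constructor
    · intro h i j hij
      refine h (.inf (.var i) (.var j), .bot) ?_
      simp only [disjointIdentity, List.mem_map, List.mem_filter]
      exact ⟨(i, j), ⟨List.pair_mem_product.2 ⟨List.mem_finRange _, List.mem_finRange _⟩,
        by simpa using hij⟩, rfl⟩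
    · intro h e he
      simp only [disjointIdentity, List.mem_map, List.mem_filter] at he
      obtain ⟨p, ⟨-, hp⟩, rfl⟩ := he
      exact h p.1 p.2 (by simpa using hp)
  constructor
  · intro h x hx
    -- Only the variables below `m + 1` occur, so the default `⊥` is immaterial.
    let v : ℕ → A := fun n => if hn : n < m + 1 then x ⟨n, hn⟩ else ⊥
    have hv : ∀ i : Fin (m + 1), v i = x i := fun i => dif_pos i.2
    have := h v ((key2 v).2 fun i j hij => by rw [hv, hv]; exact hx i j hij)
    rw [key] at this
    simp only [hv] at this
    exact this
  · intro h v hv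
    rw [key]
    exact h _ ((key2 v).1 hv)

theorem Q_subset_Pa {m : ℕ} (hm : 1 ≤ m) {A : PAlg.{u}} (hA : DisjointComplSup m A) :
    Q A ⊆ Pa.{u} m := fun _ hB =>
  (mem_Pa_iff hm).2 (satisfies_disjointIdentity.1
    (mem_Q_iff.1 hB _ (satisfies_disjointIdentity.2 hA)))

theorem Pa_subset_Q {m : ℕ} (hm : 1 ≤ m) {A : PAlg.{u}} (hA : PAlg.mk (BBar.{u} m) ∈ Q A) :
    Pa.{u} m ⊆ Q A := fun _ hB =>
  Q_subset hA (mem_Q_of_separated fun _ _ hab => exists_hom_ne ((mem_Pa_iff hm).1 hB) hab)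

/-- The premises of the quasi-identity that describes the operation tables of a finite algebra,
the element `a` being denoted by the variable `e a`. -/
noncomputable def diagram {B : Type u} [PAlgebra B] [Fintype B] (e : B → ℕ) :
    List (PTerm × PTerm) :=
  (.var (e ⊥), .bot) :: (.var (e ⊤), .top) ::
    (Finset.univ.toList.map fun a : B => (.var (e aᶜ), .compl (.var (e a)))) ++
    (Finset.univ.toList.map fun p : B × B =>
      (.var (e (p.1 ⊓ p.2)), .inf (.var (e p.1)) (.var (e p.2)))) ++
    (Finset.univ.toList.map fun p : B × B =>
      (.var (e (p.1 ⊔ p.2)), .sup (.var (e p.1)) (.var (e p.2))))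

/-- The quasi-identity "diagram of `B` implies `a ≈ b`" fails in `B`, hence in `A`; an assignment
refuting it in `A` is the required homomorphism. -/
theorem exists_hom_ne_of_mem_Q {A B : PAlg.{u}} [Finite B] (h : B ∈ Q A) {a b : B} (hab : a ≠ b) :
    ∃ f : PAlgHom B A, f.toFun a ≠ f.toFun b := by
  have := Fintype.ofFinite B
  let e : B → ℕ := fun x => Finite.equivFin B x
  have he : Function.Injective e := Fin.val_injective.comp (Equiv.injective _)
  have hB : ¬ B.Satisfies ⟨diagram e, .var (e a), .var (e b)⟩ := by
    intro hs
    have hinv := Function.leftInverse_invFun he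
    have : Nonempty B := ⟨a⟩
    refine hab ?_
    have := hs (Function.invFun e) (by
      intro p hp
      simp only [diagram, List.mem_cons, List.mem_append, List.mem_map, List.cons_append] at hp
      rcases hp with rfl | rfl | (⟨x, -, rfl⟩ | ⟨x, -, rfl⟩) | ⟨x, -, rfl⟩ <;>
        simp only [PTerm.eval, hinv _])
    simpa only [PTerm.eval, hinv _] using this
  have hA : ¬ A.Satisfies ⟨diagram e, .var (e a), .var (e b)⟩ :=
    fun hA => hB (mem_Q_iff.1 h _ hA)
  simp only [Satisfies, not_forall] at hA
  obtain ⟨v, hv, hne⟩ := hA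
  have hmem : ∀ p, p ∈ diagram e → p.1.eval v = p.2.eval v := hv
  refine ⟨{ toFun := fun x => v (e x), map_sup' := ?_, map_inf' := ?_, map_top' := ?_,
            map_bot' := ?_, map_compl' := ?_ }, hne⟩
  · exact fun x y => hmem (.var (e (x ⊔ y)), .sup (.var (e x)) (.var (e y)))
      (List.mem_append_right _ (List.mem_map.2 ⟨(x, y), by simp, rfl⟩))
  · exact fun x y => hmem (.var (e (x ⊓ y)), .inf (.var (e x)) (.var (e y)))
      (List.mem_append_left _ (List.mem_append_right _ (List.mem_map.2 ⟨(x, y), by simp, rfl⟩)))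
  · exact hmem (.var (e ⊤), .top) (by simp [diagram])
  · exact hmem (.var (e ⊥), .bot) (by simp [diagram])
  · exact fun x => hmem (.var (e xᶜ), .compl (.var (e x)))
      (List.mem_append_left _ (List.mem_append_left _ (List.mem_cons_of_mem _
        (List.mem_cons_of_mem _ (List.mem_map.2 ⟨x, by simp, rfl⟩)))))

theorem exists_lift {α β γ : Type u} [PAlgebra α] [PAlgebra β] [PAlgebra γ] (j : PAlgHom α β)
    (hj : Function.Injective j.toFun) (h : PAlgHom γ β)
    (hr : ∀ c, ∃ a, j.toFun a = h.toFun c) :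
    ∃ g : PAlgHom γ α, ∀ c, j.toFun (g.toFun c) = h.toFun c := by
  choose g hg using hr
  refine ⟨{ toFun := g, map_sup' := ?_, map_inf' := ?_, map_top' := ?_,
            map_bot' := ?_, map_compl' := ?_ }, hg⟩
  · exact fun x y => hj ((hg _).trans ((h.map_sup' x y).trans
      ((congrArg₂ _ (hg x).symm (hg y).symm).trans (j.map_sup' _ _).symm)))
  · exact fun x y => hj ((hg _).trans ((h.map_inf' x y).trans
      ((congrArg₂ _ (hg x).symm (hg y).symm).trans (j.map_inf' _ _).symm)))
  · exact hj ((hg _).trans (h.map_top'.trans j.map_top'.symm))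
  · exact hj ((hg _).trans (h.map_bot'.trans j.map_bot'.symm))
  · exact fun x => hj ((hg _).trans ((h.map_compl' x).trans
      ((congrArg _ (hg x).symm).trans (j.map_compl' _).symm)))

/-! ### The reduction of a poset -/

section Sharp

variable {P : Type u} [PartialOrder P]

theorem maxAbove_anti {x y : P} (h : x ≤ y) : maxAbove y ⊆ maxAbove x :=
  fun _ hz => ⟨h.trans hz.1, hz.2⟩

theorem exists_mem_maxAbove [Finite P] (x : P) : ∃ y, y ∈ maxAbove x := by
  obtain ⟨y, hxy, hy⟩ := (Set.toFinite (Set.univ : Set P)).exists_le_maximal (Set.mem_univ x)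
  exact ⟨y, hxy, fun z hz => hy.2 (Set.mem_univ z) hz⟩

/-- The canonical map of a poset onto its reduction. -/
def toSharp (x : P) : Sharp P := ⟨maxAbove x, x, rfl⟩

theorem toSharp_mono {x y : P} (h : x ≤ y) : toSharp x ≤ toSharp y := maxAbove_anti h

theorem toSharp_surjective : Function.Surjective (toSharp : P → Sharp P) := by
  rintro ⟨_, x, rfl⟩
  exact ⟨x, rfl⟩

/-- Any element above `toSharp x` lies below the image of some element above `x`. -/
theorem exists_le_toSharp [Finite P] {x : P} {A : Sharp P} (h : toSharp x ≤ A) :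
    ∃ y, x ≤ y ∧ A ≤ toSharp y := by
  obtain ⟨z, rfl⟩ := toSharp_surjective A
  obtain ⟨y, hy⟩ := exists_mem_maxAbove z
  exact ⟨y, (h hy).1, toSharp_mono hy.1⟩

/-- The embedding of `ε(P♯)` into `ε(P)`. -/
def sharpHom (P : Type u) [PartialOrder P] [Finite P] : PAlgHom (Upset (Sharp P)) (Upset P) where
  toFun U := ⟨{x | toSharp x ∈ U.1}, fun _ _ hxy hx => U.2 (toSharp_mono hxy) hx⟩
  map_sup' _ _ := rfl
  map_inf' _ _ := rfl
  map_top' := rfl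
  map_bot' := rfl
  map_compl' U := by
    refine Subtype.ext (Set.ext fun x => ⟨fun h y hxy hy => h _ (toSharp_mono hxy) hy, ?_⟩)
    -- `A` need not be the image of an element above `x`; some image above `A` is enough, since `U`
    -- is an upset.
    intro h A hA hAU
    obtain ⟨y, hxy, hAy⟩ := exists_le_toSharp hA
    exact h y hxy (U.2 hAy hAU)

theorem sharpHom_injective [Finite P] : Function.Injective (sharpHom P).toFun := by
  intro U V h
  refine Subtype.ext (Set.ext fun A => ?_)
  obtain ⟨x, rfl⟩ := toSharp_surjective A
  exact Set.ext_iff.1 (congrArg Subtype.val h) x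

/-- In a finite poset, `x ∈ Uᶜ` exactly when no member of `M(x)` lies in `U`. -/
theorem exists_sharpHom_eq_compl [Finite P] (U : Upset P) :
    ∃ V, (sharpHom P).toFun V = Uᶜ := by
  refine ⟨⟨{A | ∀ y ∈ A.1, y ∉ U.1}, fun A B hAB hA y hy => hA y (hAB hy)⟩, ?_⟩
  refine Subtype.ext (Set.ext fun x => ⟨fun h y hxy hy => ?_, fun h y hy => h y hy.1⟩)
  obtain ⟨z, hz⟩ := exists_mem_maxAbove y
  exact h z (maxAbove_anti hxy hz) (U.2 hz.1 hy)

/-- Replacing each `x i` by `(x i)ᶜᶜ` preserves disjointness and the pseudocomplements, and moves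
the elements into the image of `sharpHom P`. -/
theorem disjointComplSup_of_sharp [Finite P] {m : ℕ}
    (h : DisjointComplSup m (Upset (Sharp P))) : DisjointComplSup m (Upset P) := by
  intro x hx
  choose y hy using fun i => exists_sharpHom_eq_compl (x i)ᶜ
  have hdis : ∀ i j, i ≠ j → y i ⊓ y j = ⊥ := by
    intro i j hij
    apply sharpHom_injective
    refine ((sharpHom P).map_inf' _ _).trans (Eq.trans ?_ (sharpHom P).map_bot'.symm)
    refine (congrArg₂ _ (hy i) (hy j)).trans ?_
    have h1 : (x i)ᶜᶜ ≤ (x j)ᶜ := by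
      rw [← compl_compl_compl_eq (x j)]
      exact compl_anti (compl_anti (le_compl_iff.2 (hx i j hij)))
    exact le_bot_iff.1 ((inf_le_inf_right _ h1).trans (inf_compl_eq_bot _).le)
  have h2 := map_finset_sup (sharpHom P).toBoundedLatticeHom Finset.univ (fun i => (y i)ᶜ)
  refine Eq.trans ?_ (h2.symm.trans ((congrArg _ (h y hdis)).trans (sharpHom P).map_top'))
  refine Finset.sup_congr rfl fun i _ => ?_
  exact ((congrArg _ (hy i)).trans (compl_compl_compl_eq _)).symm.trans
    ((sharpHom P).map_compl' _).symm

end Sharp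

/-! ### Transferring `BBar m` to the reduction -/

theorem BBar.cases_one (x : BBar.{u} 1) : x = ⊥ ∨ x = ofSet Set.univ ∨ x = ⊤ := by
  rcases eq_top_or_eq_ofSet x with rfl | ⟨s, rfl⟩
  · exact Or.inr (Or.inr rfl)
  · rcases s.eq_empty_or_nonempty with rfl | hs
    · exact Or.inl ofSet_empty
    · exact Or.inr (Or.inl (by rw [Subsingleton.eq_univ_of_nonempty hs]))

open Classical in
/-- A dense element other than `⊤` yields an embedding of the three-element chain. -/
theorem BBar_one_mem_Q {A : PAlg.{u}} {d : A} (hd : d ≠ ⊤) (hd' : dᶜ = ⊥) :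
    PAlg.mk (BBar.{u} 1) ∈ Q A := by
  have ht : (BBar.ofSet Set.univ : BBar.{u} 1) ≠ ⊤ := BBar.ofSet_ne_top _
  have hb : (BBar.ofSet Set.univ : BBar.{u} 1) ≠ ⊥ := fun h =>
    Set.univ_nonempty.ne_empty (BBar.ofSet_injective (h.trans BBar.ofSet_empty.symm))
  have htb : (⊤ : BBar.{u} 1) ≠ ⊥ := fun h => BBar.ofSet_ne_top _ (BBar.ofSet_empty.trans h.symm)
  have hc : (BBar.ofSet Set.univ : BBar.{u} 1)ᶜ = ⊥ := by
    rw [BBar.compl_ofSet Set.univ_nonempty.ne_empty, Set.compl_univ, BBar.ofSet_empty]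
  have hd0 : d ≠ ⊥ := by
    rintro rfl
    exact hd (hd'.symm.trans compl_bot_eq)
  have htb' : (⊤ : A) ≠ ⊥ := fun h => hd0 (le_bot_iff.1 (h ▸ le_top))
  let g : BBar.{u} 1 → A := fun x => if x = ⊥ then ⊥ else if x = ⊤ then ⊤ else d
  have g0 : g ⊥ = ⊥ := if_pos rfl
  have g1 : g ⊤ = ⊤ := by simp [g, htb]
  have gd : g (BBar.ofSet Set.univ) = d := by simp [g, ht, hb]
  refine mem_Q_of_injective
    { toFun := g, map_sup' := ?_, map_inf' := ?_, map_top' := g1, map_bot' := g0,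
      map_compl' := ?_ } ?_
  · intro x y
    rcases BBar.cases_one x with rfl | rfl | rfl <;>
      rcases BBar.cases_one y with rfl | rfl | rfl <;> simp [g0, g1, gd]
  · intro x y
    rcases BBar.cases_one x with rfl | rfl | rfl <;>
      rcases BBar.cases_one y with rfl | rfl | rfl <;> simp [g0, g1, gd]
  · intro x
    change g xᶜ = (g x)ᶜ
    rcases BBar.cases_one x with rfl | rfl | rfl <;>
      simp only [g0, g1, gd, hc, hd', compl_bot_eq, compl_top_eq]
  · intro x y hxy
    change g x = g y at hxy
    rcases BBar.cases_one x with rfl | rfl | rfl <;>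
      rcases BBar.cases_one y with rfl | rfl | rfl <;>
      simp_all [hd.symm, hd0.symm, htb'.symm]

/-- Take `d = (x 0)ᶜ ⊔ (x 1)ᶜ` for disjoint `x 0`, `x 1` violating the condition. Then `x 1 ≤ (x 0)ᶜ
≤ d`, so `dᶜ ≤ (x 1)ᶜ ≤ d` and `dᶜ = ⊥`. -/
theorem exists_dense {α : Type u} [PAlgebra α] (h : ¬ DisjointComplSup 1 α) :
    ∃ d : α, d ≠ ⊤ ∧ dᶜ = ⊥ := by
  simp only [DisjointComplSup, not_forall] at h
  obtain ⟨x, hx, hne⟩ := h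
  refine ⟨_, hne, le_bot_iff.1 ?_⟩
  set d := Finset.univ.sup fun i => (x i)ᶜ with hd
  have h0 : (x 0)ᶜ ≤ d := Finset.le_sup (f := fun i => (x i)ᶜ) (Finset.mem_univ 0)
  have h1 : (x 1)ᶜ ≤ d := Finset.le_sup (f := fun i => (x i)ᶜ) (Finset.mem_univ 1)
  have hx1 : x 1 ≤ d := le_trans (le_compl_iff.2 (hx 1 0 (by decide))) h0
  exact (le_inf le_rfl ((compl_anti hx1).trans h1)).trans (compl_inf_eq_bot d).le

theorem BBar_mem_Q_sharp {P : Type u} [PartialOrder P] [Finite P] {m : ℕ} (hm : 2 ≤ m)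
    (h : PAlg.mk (BBar.{u} m) ∈ Q (dualAlg P)) :
    PAlg.mk (BBar.{u} m) ∈ Q (dualAlg (Sharp P)) := by
  have : Finite (BBar.{u} m) := inferInstanceAs (Finite (Option (Set (ULift.{u} (Fin m)))))
  refine mem_Q_of_separated fun a b hab => ?_
  have : Finite (PAlg.mk (BBar.{u} m)) := this
  obtain ⟨f, hf⟩ := exists_hom_ne_of_mem_Q h hab
  have hcompl : ∀ c : BBar.{u} m, ∃ V, (sharpHom P).toFun V = f.toFun cᶜ := by
    intro c
    obtain ⟨V, hV⟩ := exists_sharpHom_eq_compl (f.toFun c)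
    exact ⟨V, hV.trans (f.map_compl' c).symm⟩
  have hproper : ∀ s : Set (ULift.{u} (Fin m)), s ≠ Set.univ →
      ∃ V, (sharpHom P).toFun V = f.toFun (BBar.ofSet s) := by
    intro s hs
    have : BBar.ofSet s = (BBar.ofSet sᶜ)ᶜ := by
      rw [BBar.compl_ofSet (by simpa using hs), compl_compl]
    rw [this]
    exact hcompl _
  have hrange : ∀ c : BBar.{u} m, ∃ V, (sharpHom P).toFun V = f.toFun c := by
    intro c
    rcases BBar.eq_top_or_eq_ofSet c with rfl | ⟨s, rfl⟩
    · exact ⟨⊤, (sharpHom P).map_top'.trans f.map_top'.symm⟩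
    -- The full set is not a pseudocomplement, but for `2 ≤ m` it is the join of `{i}` and `{i}ᶜ`,
    -- both proper.
    by_cases hs : s = Set.univ
    · have : Nontrivial (Fin m) := Fin.nontrivial_iff_two_le.2 hm
      obtain ⟨i, j, hij⟩ := exists_pair_ne (ULift.{u} (Fin m))
      obtain ⟨V, hV⟩ := hproper {i} fun h => hij (by have := h.ge (Set.mem_univ j); exact this.symm)
      obtain ⟨W, hW⟩ := hproper {i}ᶜ fun h => (h.ge (Set.mem_univ i) : i ∉ ({i} : Set _)) rfl
      refine ⟨V ⊔ W, ((sharpHom P).map_sup' V W).trans ((congrArg₂ _ hV hW).trans ?_)⟩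
      refine (f.map_sup' _ _).symm.trans (congrArg f.toFun ?_)
      exact (BBar.ofSet_sup _ _).trans (by rw [hs, Set.union_compl_self])
    · exact hproper s hs
  obtain ⟨g, hg⟩ := exists_lift (sharpHom P) sharpHom_injective f hrange
  exact ⟨g, fun h => hf ((hg a).symm.trans ((congrArg _ h).trans (hg b)))⟩

theorem sharp_mem_Q {P : Type u} [PartialOrder P] [Finite P] :
    dualAlg (Sharp P) ∈ Q (dualAlg P) :=
  mem_Q_of_injective (sharpHom P) sharpHom_injective

theorem BBar_mem_Pa {m : ℕ} (hm : 1 ≤ m) : PAlg.mk (BBar.{u} m) ∈ Pa.{u} m :=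
  (mem_Pa_iff hm).2 (BBar.disjointComplSup hm)

theorem Pa_ssubset_Q_sharp {P : Type u} [PartialOrder P] [Finite P] {m : ℕ} (hm : 1 ≤ m)
    (h : Pa.{u} m ⊂ Q (dualAlg P)) : Pa.{u} m ⊂ Q (dualAlg (Sharp P)) := by
  have hnot : ¬ DisjointComplSup m (Upset (Sharp P)) := fun hD =>
    h.2 (Q_subset_Pa hm (disjointComplSup_of_sharp hD))
  refine ⟨Pa_subset_Q hm ?_, fun hsub => hnot ((mem_Pa_iff hm).1 (hsub (self_mem_Q _)))⟩
  -- For `m = 1` the middle element of the chain is not a join of pseudocomplements, so lifting is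
  -- unavailable and the failure of `DisjointComplSup 1` is used instead.
  rcases hm.eq_or_lt with rfl | hm2
  · obtain ⟨d, hd, hd'⟩ := exists_dense hnot
    exact BBar_one_mem_Q (A := dualAlg (Sharp P)) hd hd'
  · exact BBar_mem_Q_sharp hm2 (h.1 (BBar_mem_Pa hm))

end PAlg

/-! ### The strict inclusion and its consequence for covers -/

theorem lemma2p4 {P : Type u} [PartialOrder P] [Finite P] (m : ℕ) (hm : 1 ≤ m) :
    (PAlg.Pa.{u} m ⊂ PAlg.Q (PAlg.dualAlg P) →
      PAlg.Pa.{u} m ⊂ PAlg.Q (PAlg.dualAlg (PAlg.Sharp P)) ∧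
        PAlg.Q (PAlg.dualAlg (PAlg.Sharp P)) ⊆ PAlg.Q (PAlg.dualAlg P)) ∧
    (PAlg.IsCover (PAlg.Pa.{u} m) (PAlg.Q (PAlg.dualAlg P)) →
      PAlg.Q (PAlg.dualAlg P) = PAlg.Q (PAlg.dualAlg (PAlg.Sharp P))) := by
  have hsub := PAlg.Q_subset (PAlg.sharp_mem_Q (P := P))
  refine ⟨fun h => ⟨PAlg.Pa_ssubset_Q_sharp hm h, hsub⟩, fun h => ?_⟩
  by_contra hne
  exact h.2 _ (PAlg.isQuasivariety_Q _)
    ⟨PAlg.Pa_ssubset_Q_sharp hm h.1, hsub.ssubset_of_ne (Ne.symm hne)⟩
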